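/- Let $E$ be a complex Banach lattice, i.e. the complexification $E = E_{\mathbb{R}} \oplus iE_{\mathbb{R}}$ of a real Banach lattice $E_{\mathbb{R}}$, with modulus $|x+iy| = \sup_{\theta\in\mathbb{R}} (x\cos\theta + y\sin\theta) \in E_{\mathbb{R}}$ and norm $\|z\| = \|\,|z|\,\|$; for $x,y\in E$ we write $x \le y$ if $x,y\in E_{\mathbb{R}}$ and $x\le y$ there. Let $T$ be a bounded linear operator on $E$ which is positive ($Tx \ge 0$ whenever $x \ge 0$), and let $\lambda \in \mathbb{C}$ with $|\lambda| = 1$ be an eigenvalue of $T$ with eigenvector $z$. Assume that at least one of the following holds: (a) $\sup_{n \in \mathbb{N}_0} \|T^n|z|\| < \infty$; (b) $1$ is an eigenvalue of $T$ and possesses an eigenvector $x$ with $x \ge |z|$. Let $T''$ denote the bi-adjoint of $T$, acting on the bidual $E''$ of $E$; let $\sigma_{\mathrm{pnt}}(T'')$ be the set of its eigenvalues and $\sigma(T)$ the spectrum of $T$. Then $\lambda^k \in \sigma_{\mathrm{pnt}}(T'') \subset \sigma(T)$ for every $k \in \mathbb{Z}$; that is, $\sigma_{\mathrm{pnt}}(T'')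 \subset \sigma(T)$, and each $\lambda^k$ $(k\in\mathbb{Z})$ is an eigenvalue of $T''$ and hence lies in $\sigma(T)$. -/

import Mathlib

/-- The complexification `F ⊕ iF` of a real vector space `F`; an element is written `re + i * im`. -/
@[ext]
structure Complexification (F : Type*) where
  re : F
  im : F

namespace Complexification

section VectorSpace

variable {F : Type*} [AddCommGroup F]

instance : Zero (Complexification F) := ⟨⟨0, 0⟩⟩
instance : Add (Complexification F) := ⟨fun z w => ⟨z.re + w.re, z.im + w.im⟩⟩
instance : Neg (Complexification F) := ⟨fun z => ⟨-z.re, -z.im⟩⟩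
instance : Sub (Complexification F) := ⟨fun z w => ⟨z.re - w.re, z.im - w.im⟩⟩

@[simp] theorem zero_re : (0 : Complexification F).re = 0 := rfl
@[simp] theorem zero_im : (0 : Complexification F).im = 0 := rfl
@[simp] theorem add_re (z w : Complexification F) : (z + w).re = z.re + w.re := rfl
@[simp] theorem add_im (z w : Complexification F) : (z + w).im = z.im + w.im := rfl
@[simp] theorem neg_re (z : Complexification F) : (-z).re = -z.re := rfl
@[simp] theorem neg_im (z : Complexification F) : (-z).im = -z.im := rfl
@[simp] theorem sub_re (z w : Complexification F) : (z - w).re = z.re - w.re := rfl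
@[simp] theorem sub_im (z w : Complexification F) : (z - w).im = z.im - w.im := rfl

instance : AddCommGroup (Complexification F) where
  add_assoc a b c := by ext <;> simp [add_assoc]
  zero_add a := by ext <;> simp
  add_zero a := by ext <;> simp
  add_comm a b := by ext <;> simp [add_comm]
  neg_add_cancel a := by ext <;> simp
  sub_eq_add_neg a b := by ext <;> simp [sub_eq_add_neg]
  nsmul := nsmulRec
  zsmul := zsmulRec

variable [Module ℝ F]

/-- `(a + ib)(x + iy) = (ax - by) + i(ay + bx)`. -/
instance : SMul ℂ (Complexification F) :=
  ⟨fun c z => ⟨c.re • z.re - c.im • z.im, c.re • z.im + c.im • z.re⟩⟩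

@[simp] theorem smul_re (c : ℂ) (z : Complexification F) :
    (c • z).re = c.re • z.re - c.im • z.im := rfl
@[simp] theorem smul_im (c : ℂ) (z : Complexification F) :
    (c • z).im = c.re • z.im + c.im • z.re := rfl

instance : Module ℂ (Complexification F) where
  one_smul z := by ext <;> simp
  mul_smul c d z := by
    ext <;> simp only [smul_re, smul_im, Complex.mul_re, Complex.mul_im] <;> module
  smul_zero c := by ext <;> simp
  smul_add c z w := by ext <;> simp only [smul_re, smul_im, add_re, add_im] <;> module
  add_smul c d z := by
    ext <;> simp only [smul_re, smul_im, add_re, add_im, Complex.add_re, Complex.add_im] <;> module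
  zero_smul z := by ext <;> simp

end VectorSpace

/-- The rotated real part `cos θ • x + sin θ • y` of `z = x + iy`. -/
noncomputable def rot {F : Type*} [AddCommGroup F] [Module ℝ F]
    (z : Complexification F) (θ : ℝ) : F :=
  Real.cos θ • z.re + Real.sin θ • z.im

section BanachLattice

set_option linter.unusedSectionVars false

/- `F` is a real Banach lattice. -/
variable {F : Type*} [NormedAddCommGroup F] [Lattice F] [HasSolidNorm F] [IsOrderedAddMonoid F]
  [NormedSpace ℝ F] [IsOrderedModule ℝ F]

theorem smul_le_smul_abs {r c : ℝ} (h : |r| ≤ c) (x : F) : r • x ≤ c • |x| := by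
  have h1 : r • x ≤ |r| • |x| := by
    rcases le_total 0 r with hr | hr
    · rw [abs_of_nonneg hr]
      exact smul_le_smul_of_nonneg_left (le_abs_self x) hr
    · rw [abs_of_nonpos hr, ← neg_smul_neg]
      exact smul_le_smul_of_nonneg_left (neg_le_abs x) (neg_nonneg.2 hr)
  exact h1.trans (smul_le_smul_of_nonneg_right h (abs_nonneg x))

theorem rot_le_rot_add (z : Complexification F) (θ η : ℝ) :
    z.rot θ ≤ z.rot η + |θ - η| • (|z.re| + |z.im|) := by
  have h1 := smul_le_smul_abs (Real.abs_cos_sub_cos_le θ η) z.re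
  have h2 := smul_le_smul_abs (Real.abs_sin_sub_sin_le θ η) z.im
  have h3 := add_le_add h1 h2
  have h4 : z.rot θ = z.rot η +
      ((Real.cos θ - Real.cos η) • z.re + (Real.sin θ - Real.sin η) • z.im) := by
    simp only [rot]; module
  rw [h4, smul_add]
  exact add_le_add le_rfl h3

/-- Supremum of `rot z` over `n + 1` equidistributed angles. -/
noncomputable def gridSup (z : Complexification F) (n : ℕ) : F :=
  (Finset.range (n + 1)).sup' Finset.nonempty_range_add_one
    fun k => z.rot (2 * Real.pi * k / (n + 1))

theorem rot_le_gridSup (z : Complexification F) (θ : ℝ) (n : ℕ) :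
    z.rot θ ≤ z.gridSup n + (2 * Real.pi / (n + 1)) • (|z.re| + |z.im|) := by
  have hp : (0 : ℝ) < 2 * Real.pi := Real.two_pi_pos
  have hn : (0 : ℝ) < n + 1 := by positivity
  obtain ⟨η, ⟨h0, h1⟩, h2⟩ : ∃ η ∈ Set.Ico 0 (2 * Real.pi), z.rot θ = z.rot η := by
    refine ⟨toIcoMod hp 0 θ, by simpa using toIcoMod_mem_Ico hp 0 θ, ?_⟩
    have : toIcoMod hp 0 θ = θ - (toIcoDiv hp 0 θ : ℝ) * (2 * Real.pi) := by
      rw [← self_sub_toIcoDiv_zsmul, zsmul_eq_mul]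
    rw [this, rot, rot, Real.cos_sub_int_mul_two_pi, Real.sin_sub_int_mul_two_pi]
  set t : ℝ := η * (n + 1) / (2 * Real.pi) with ht
  have ht0 : 0 ≤ t := by positivity
  have ht1 : t < n + 1 := by
    rw [ht, div_lt_iff₀ hp]; nlinarith
  have hk : ⌊t⌋₊ < n + 1 := by
    rw [Nat.floor_lt ht0]; exact_mod_cast ht1
  have hη : η = 2 * Real.pi * t / (n + 1) := by
    rw [ht]; field_simp
  have hd : |η - 2 * Real.pi * ⌊t⌋₊ / (n + 1)| ≤ 2 * Real.pi / (n + 1) := by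
    have e : η - 2 * Real.pi * ⌊t⌋₊ / (n + 1) = 2 * Real.pi / (n + 1) * (t - ⌊t⌋₊) := by
      nth_rewrite 1 [hη]; ring
    have e1 := Nat.floor_le ht0
    have e2 := Nat.lt_floor_add_one t
    rw [e, abs_of_nonneg (mul_nonneg (by positivity) (by linarith))]
    exact mul_le_of_le_one_right (by positivity) (by linarith)
  rw [h2]
  refine (rot_le_rot_add z η (2 * Real.pi * ⌊t⌋₊ / (n + 1))).trans (add_le_add ?_ ?_)
  · exact Finset.le_sup' (fun k : ℕ => z.rot (2 * Real.pi * k / (n + 1))) (Finset.mem_range.2 hk)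
  · exact smul_le_smul_of_nonneg_right hd (add_nonneg (abs_nonneg _) (abs_nonneg _))

variable [CompleteSpace F]

/-- In a real Banach lattice the supremum defining the modulus always exists. -/
theorem exists_isLUB_rot (z : Complexification F) : ∃ m : F, IsLUB (Set.range z.rot) m := by
  set u : F := |z.re| + |z.im| with hu
  have hle : ∀ m n : ℕ, z.gridSup m ≤ z.gridSup n + (2 * Real.pi / (n + 1)) • u := fun m n =>
    Finset.sup'_le _ _ fun k _ => rot_le_gridSup z _ n
  have hc : Filter.Tendsto (fun n : ℕ => 2 * Real.pi / ((n : ℝ) + 1)) Filter.atTop (nhds 0) := by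
    simpa [div_eq_mul_inv] using
      (tendsto_one_div_add_atTop_nhds_zero_nat (𝕜 := ℝ)).const_mul (2 * Real.pi)
  have hcs : CauchySeq z.gridSup := by
    rw [Metric.cauchySeq_iff']
    intro ε hε
    have hε' : 0 < ε / (2 * (‖u‖ + 1)) := by positivity
    obtain ⟨N, hN⟩ := (hc.eventually (gt_mem_nhds hε')).exists_forall_of_atTop
    refine ⟨N, fun n hn => ?_⟩
    have hcn := hN n hn
    have hcN := hN N le_rfl
    set c : ℝ := ε / (2 * (‖u‖ + 1))
    have hu0 : 0 ≤ u := add_nonneg (abs_nonneg _) (abs_nonneg _)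
    have hab : |z.gridSup n - z.gridSup N| ≤ |c • u| := by
      rw [abs_of_nonneg (smul_nonneg hε'.le hu0)]
      refine abs_le'.2 ⟨?_, ?_⟩
      · rw [sub_le_iff_le_add']
        exact (hle n N).trans (add_le_add le_rfl (smul_le_smul_of_nonneg_right hcN.le hu0))
      · rw [neg_sub, sub_le_iff_le_add']
        exact (hle N n).trans (add_le_add le_rfl (smul_le_smul_of_nonneg_right hcn.le hu0))
    rw [dist_eq_norm]
    refine (norm_le_norm_of_abs_le_abs hab).trans_lt ?_
    rw [norm_smul, Real.norm_of_nonneg hε'.le]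
    have : c * (2 * (‖u‖ + 1)) = ε := by simp only [c]; field_simp
    nlinarith [norm_nonneg u]
  obtain ⟨a, ha⟩ := cauchySeq_tendsto_of_complete hcs
  refine ⟨a, ?_, ?_⟩
  · rintro _ ⟨θ, rfl⟩
    have h1 : Filter.Tendsto (fun n : ℕ => z.gridSup n + (2 * Real.pi / ((n : ℝ) + 1)) • u)
        Filter.atTop (nhds (a + (0 : ℝ) • u)) := ha.add (hc.smul_const u)
    rw [zero_smul, add_zero] at h1
    exact ge_of_tendsto' h1 fun n => rot_le_gridSup z θ n
  · intro b hb
    exact le_of_tendsto' ha fun n => Finset.sup'_le _ _ fun k _ => hb ⟨_, rfl⟩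

/-- The modulus `|x + iy| = sup {cos θ • x + sin θ • y | θ ∈ ℝ}`, as an element of the real part
`F`. -/
@[irreducible]
noncomputable def modulus (z : Complexification F) : F :=
  (exists_isLUB_rot z).choose

theorem isLUB_modulus (z : Complexification F) : IsLUB (Set.range z.rot) z.modulus := by
  unfold modulus
  exact (exists_isLUB_rot z).choose_spec

theorem rot_le_modulus (z : Complexification F) (θ : ℝ) : z.rot θ ≤ z.modulus :=
  (isLUB_modulus z).1 ⟨θ, rfl⟩

theorem modulus_le {z : Complexification F} {b : F} (h : ∀ θ, z.rot θ ≤ b) : z.modulus ≤ b :=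
  (isLUB_modulus z).2 (by rintro _ ⟨θ, rfl⟩; exact h θ)

theorem abs_re_le_modulus (z : Complexification F) : |z.re| ≤ z.modulus :=
  abs_le'.2 ⟨by simpa [rot] using rot_le_modulus z 0, by simpa [rot] using rot_le_modulus z Real.pi⟩

theorem abs_im_le_modulus (z : Complexification F) : |z.im| ≤ z.modulus :=
  abs_le'.2 ⟨by simpa [rot] using rot_le_modulus z (Real.pi / 2),
    by simpa [rot] using rot_le_modulus z (-(Real.pi / 2))⟩

theorem modulus_nonneg (z : Complexification F) : 0 ≤ z.modulus :=
  (abs_nonneg _).trans (abs_re_le_modulus z)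

theorem modulus_le_abs_add_abs (z : Complexification F) : z.modulus ≤ |z.re| + |z.im| :=
  modulus_le fun θ => by
    have h1 := smul_le_smul_abs (Real.abs_cos_le_one θ) z.re
    have h2 := smul_le_smul_abs (Real.abs_sin_le_one θ) z.im
    rw [one_smul] at h1 h2
    exact add_le_add h1 h2

theorem modulus_add_le (z w : Complexification F) :
    (z + w).modulus ≤ z.modulus + w.modulus :=
  modulus_le fun θ => by
    have e : (z + w).rot θ = z.rot θ + w.rot θ := by simp only [rot, add_re, add_im]; module
    rw [e]
    exact add_le_add (rot_le_modulus z θ) (rot_le_modulus w θ)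

theorem modulus_smul_le (c : ℂ) (z : Complexification F) :
    (c • z).modulus ≤ ‖c‖ • z.modulus :=
  modulus_le fun θ => by
    have e : (c • z).rot θ = ‖c‖ • z.rot (θ - c.arg) := by
      simp only [rot, smul_re, smul_im, Real.cos_sub, Real.sin_sub]
      nth_rewrite 1 2 [← Complex.norm_mul_cos_arg c]
      nth_rewrite 1 2 [← Complex.norm_mul_sin_arg c]
      module
    rw [e]
    exact smul_le_smul_of_nonneg_left (rot_le_modulus z _) (norm_nonneg c)

/-- The norm of the complex Banach lattice: `‖z‖ = ‖ |z| ‖`. -/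
noncomputable instance : Norm (Complexification F) := ⟨fun z => ‖z.modulus‖⟩

theorem norm_le_norm_of_le {x y : F} (hx : 0 ≤ x) (h : x ≤ y) : ‖x‖ ≤ ‖y‖ :=
  norm_le_norm_of_abs_le_abs (by rwa [abs_of_nonneg hx, abs_of_nonneg (hx.trans h)])

theorem norm_smul_le_aux (c : ℂ) (z : Complexification F) : ‖c • z‖ ≤ ‖c‖ * ‖z‖ := by
  have h := norm_le_norm_of_le (modulus_nonneg _) (modulus_smul_le c z)
  rwa [norm_smul, norm_norm] at h

theorem normCore : NormedSpace.Core ℂ (Complexification F) where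
  norm_nonneg z := norm_nonneg (modulus z)
  norm_smul c z := by
    refine le_antisymm (norm_smul_le_aux c z) ?_
    rcases eq_or_ne c 0 with rfl | hc
    · rw [norm_zero, zero_mul]
      exact norm_nonneg (modulus ((0 : ℂ) • z))
    · have h := norm_smul_le_aux c⁻¹ (c • z)
      rw [inv_smul_smul₀ hc, norm_inv] at h
      rwa [← le_inv_mul_iff₀ (norm_pos_iff.2 hc)]
  norm_triangle z w :=
    (norm_le_norm_of_le (modulus_nonneg _) (modulus_add_le z w)).trans (norm_add_le _ _)
  norm_eq_zero_iff z := by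
    refine ⟨fun h => ?_, ?_⟩
    · have hm : z.modulus = 0 := norm_eq_zero.1 h
      have h1 := abs_re_le_modulus z
      have h2 := abs_im_le_modulus z
      rw [hm] at h1 h2
      ext
      · exact le_antisymm ((le_abs_self _).trans h1) (neg_nonpos.1 ((neg_le_abs _).trans h1))
      · exact le_antisymm ((le_abs_self _).trans h2) (neg_nonpos.1 ((neg_le_abs _).trans h2))
    · rintro rfl
      have h := modulus_le_abs_add_abs (0 : Complexification F)
      simp only [zero_re, zero_im, abs_zero, add_zero] at h
      exact norm_eq_zero.2 (le_antisymm h (modulus_nonneg _))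

noncomputable instance : NormedAddCommGroup (Complexification F) :=
  NormedAddCommGroup.ofCore normCore

noncomputable instance : NormedSpace ℂ (Complexification F) :=
  NormedSpace.ofCore normCore

theorem norm_def (z : Complexification F) : ‖z‖ = ‖z.modulus‖ := rfl

theorem norm_re_le (z : Complexification F) : ‖z.re‖ ≤ ‖z‖ := by
  rw [← norm_abs_eq_norm]
  exact norm_le_norm_of_le (abs_nonneg _) (abs_re_le_modulus z)

theorem norm_im_le (z : Complexification F) : ‖z.im‖ ≤ ‖z‖ := by
  rw [← norm_abs_eq_norm]
  exact norm_le_norm_of_le (abs_nonneg _) (abs_im_le_modulus z)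

theorem norm_le_add (z : Complexification F) : ‖z‖ ≤ ‖z.re‖ + ‖z.im‖ := by
  have h1 : ‖z.modulus‖ ≤ ‖|z.re| + |z.im|‖ :=
    norm_le_norm_of_le (modulus_nonneg _) (modulus_le_abs_add_abs z)
  have h2 : ‖|z.re| + |z.im|‖ ≤ ‖|z.re|‖ + ‖|z.im|‖ := norm_add_le _ _
  rw [norm_abs_eq_norm, norm_abs_eq_norm] at h2
  exact h1.trans h2

theorem cauchySeq_re {u : ℕ → Complexification F} (hu : CauchySeq u) :
    CauchySeq fun n => (u n).re := by
  rw [Metric.cauchySeq_iff] at hu ⊢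
  intro ε hε
  obtain ⟨N, hN⟩ := hu ε hε
  refine ⟨N, fun m hm n hn => ?_⟩
  have h := hN m hm n hn
  rw [dist_eq_norm] at h ⊢
  rw [← sub_re]
  exact (norm_re_le _).trans_lt h

theorem cauchySeq_im {u : ℕ → Complexification F} (hu : CauchySeq u) :
    CauchySeq fun n => (u n).im := by
  rw [Metric.cauchySeq_iff] at hu ⊢
  intro ε hε
  obtain ⟨N, hN⟩ := hu ε hε
  refine ⟨N, fun m hm n hn => ?_⟩
  have h := hN m hm n hn
  rw [dist_eq_norm] at h ⊢
  rw [← sub_im]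
  exact (norm_im_le _).trans_lt h

theorem tendsto_of_re_im {u : ℕ → Complexification F} {a b : F}
    (ha : Filter.Tendsto (fun n => (u n).re) Filter.atTop (nhds a))
    (hb : Filter.Tendsto (fun n => (u n).im) Filter.atTop (nhds b)) :
    Filter.Tendsto u Filter.atTop (nhds ⟨a, b⟩) := by
  have h1 : Filter.Tendsto (fun n => ‖(u n).re - a‖) Filter.atTop (nhds 0) :=
    tendsto_iff_norm_sub_tendsto_zero.1 ha
  have h2 : Filter.Tendsto (fun n => ‖(u n).im - b‖) Filter.atTop (nhds 0) :=
    tendsto_iff_norm_sub_tendsto_zero.1 hb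
  have hab := h1.add h2
  rw [add_zero] at hab
  refine tendsto_iff_norm_sub_tendsto_zero.2
    (squeeze_zero (fun n => norm_nonneg (u n - (⟨a, b⟩ : Complexification F))) (fun n => ?_) hab)
  exact norm_le_add (u n - (⟨a, b⟩ : Complexification F))

instance : CompleteSpace (Complexification F) := by
  refine Metric.complete_of_cauchySeq_tendsto fun u hu => ?_
  obtain ⟨a, ha⟩ := cauchySeq_tendsto_of_complete (cauchySeq_re hu)
  obtain ⟨b, hb⟩ := cauchySeq_tendsto_of_complete (cauchySeq_im hu)
  exact ⟨⟨a, b⟩, tendsto_of_re_im ha hb⟩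

/-- The modulus `|z|`, regarded as an element of the complex Banach lattice. -/
noncomputable def absval (z : Complexification F) : Complexification F := ⟨z.modulus, 0⟩

end BanachLattice

/-- `z ≤ w` means that `z` and `w` both lie in the real part and that `z ≤ w` there. (This is the
convention for complex Banach lattices; it is not reflexive off the real part.) -/
instance {F : Type*} [AddCommGroup F] [LE F] : LE (Complexification F) :=
  ⟨fun z w => z.im = 0 ∧ w.im = 0 ∧ z.re ≤ w.re⟩

/-- `T` is positive: `T x ≥ 0` whenever `x ≥ 0`. -/
def IsPositiveOperator {F : Type*} [NormedAddCommGroup F] [Lattice F] [HasSolidNorm F]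
    [IsOrderedAddMonoid F] [NormedSpace ℝ F] [IsOrderedModule ℝ F] [CompleteSpace F]
    (T : Complexification F →L[ℂ] Complexification F) : Prop :=
  ∀ x : Complexification F, 0 ≤ x → 0 ≤ T x

end Complexification

/-- The adjoint `T' : X' → X'`, `T' f = f ∘ T`, of a bounded operator on a complex normed space,
where `X' = StrongDual ℂ X` is the space of bounded complex linear functionals on `X`. -/
noncomputable def dualOperator {X : Type*} [NormedAddCommGroup X] [NormedSpace ℂ X]
    (T : X →L[ℂ] X) : StrongDual ℂ X →L[ℂ] StrongDual ℂ X :=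
  (ContinuousLinearMap.compL ℂ X X ℂ).flip T

/-- The point spectrum: the set of all eigenvalues. -/
def pointSpectrum {X : Type*} [NormedAddCommGroup X] [NormedSpace ℂ X]
    (T : X →L[ℂ] X) : Set ℂ :=
  {μ | Module.End.HasEigenvalue (T : X →ₗ[ℂ] X) μ}

/-! Put `m = |z|`, and let `S` be the real positive operator that `T` induces on the real part; `T z
= λ z` gives `m ≤ S m`. If `m` were fixed, `y = |z| (sgn z) ^ k` would be an eigenvector for `λ ^
k`. In general the defect is controlled: `|λ ^ k y - T y| ≤ M (S m - m)` with `M` depending only on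
`k` (`exists_modulus_apply_sub_zpow_smul_le`). The reason is convexity: `u ↦ Re (conj q |u| (sgn u)
^ k)` becomes sublinear once `M ‖q‖ |u|` is added, hence is a supremum of real-linear forms, and a
positive operator satisfies a Jensen inequality for such suprema. The same suprema, taken in the
lattice, construct `y` (`exists_isLUB_pairing_tangentVector`).

Now let `W n = λ ^ (-kn) T ^ n y`. Its increments have moduli at most `M (S ^ (n+1) m - S ^ n m)`,
which telescope, and either hypothesis bounds `‖S ^ n m‖`. So the increments form a weakly
unconditionally Cauchy series, `W n` converges weak-star to some `w` in the bidual, and `T W n = λ ^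
k W (n+1)` yields `T'' w = λ ^ k w`. That `w ≠ 0` is seen by testing against a functional dominated
by `φ (S ^ j |·|)`, `φ` positive, with `j` so large that the telescoping tail is small. Finally, an
eigenvalue of `T''` lies in the spectrum of `T`, as invertibility passes to the adjoint. -/

open scoped ComplexConjugate
open Filter Topology

namespace Complexification

/-! ### Real-linear forms on the complexification. -/

section Pairing

variable {F : Type*} [AddCommGroup F] [Module ℝ F]

/-- The real-linear form `c ↦ Re (conj c • z)` with values in the real part. -/
def pairing (z : Complexification F) : ℂ →ₗ[ℝ] F where
  toFun c := c.re • z.re + c.im • z.im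
  map_add' c d := by simp only [Complex.add_re, Complex.add_im]; module
  map_smul' r c := by
    simp only [Complex.smul_re, Complex.smul_im, smul_eq_mul, RingHom.id_apply]; module

theorem pairing_apply (z : Complexification F) (c : ℂ) :
    z.pairing c = c.re • z.re + c.im • z.im := rfl

theorem pairing_smul (w : ℂ) (z : Complexification F) (c : ℂ) :
    (w • z).pairing c = z.pairing (conj w * c) := by
  simp only [pairing_apply, smul_re, smul_im, Complex.mul_re, Complex.mul_im, Complex.conj_re,
    Complex.conj_im]
  module

theorem pairing_sub (z w : Complexification F) (c : ℂ) :
    (z - w).pairing c = z.pairing c - w.pairing c := by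
  simp only [pairing_apply, sub_re, sub_im]; module

theorem pairing_exp (z : Complexification F) (θ : ℝ) :
    z.pairing (Circle.exp θ) = z.rot θ := by
  rw [Circle.coe_exp, pairing_apply, Complex.exp_ofReal_mul_I_re, Complex.exp_ofReal_mul_I_im, rot]

end Pairing

/-! ### Suprema of bounded families of linear forms. -/

section FunctionalCalculus

variable {F : Type*} [NormedAddCommGroup F] [Lattice F] [HasSolidNorm F] [IsOrderedAddMonoid F]
  [NormedSpace ℝ F] [IsOrderedModule ℝ F]

theorem pairing_le_norm_smul (z : Complexification F) (c : ℂ) :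
    z.pairing c ≤ ‖c‖ • (|z.re| + |z.im|) := by
  rw [smul_add]
  exact add_le_add (smul_le_smul_abs (Complex.abs_re_le_norm c) _)
    (smul_le_smul_abs (Complex.abs_im_le_norm c) _)

/-- An upper bound for the forms `z.pairing a`, `a ∈ A`, bounds `z.pairing c` for each `c` in the
closed convex hull of `A`, described here through its supporting half planes. -/
theorem pairing_le_of_forall_circle {z : Complexification F} {A : Set ℂ} {b : F}
    (hA : ∀ a ∈ A, z.pairing a ≤ b) {c : ℂ}
    (hc : ∀ v : Circle, ∃ a ∈ A, (conj c * v).re ≤ (conj a * v).re) : z.pairing c ≤ b := by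
  by_contra hcb
  have hconv : Convex ℝ {c : ℂ | z.pairing c ≤ b} :=
    (convex_Iic (𝕜 := ℝ) b).linear_preimage z.pairing
  have hclosed : IsClosed {c : ℂ | z.pairing c ≤ b} :=
    isClosed_le z.pairing.continuous_of_finiteDimensional continuous_const
  obtain ⟨f, r, hf, hr⟩ := geometric_hahn_banach_closed_point hconv hclosed hcb
  -- `u` represents the separating functional as `x ↦ Re (conj x * u)`; normalized, it is the
  -- direction `v` in which `hc` contradicts the separation.
  set u : ℂ := ⟨f 1, f Complex.I⟩ with hu
  have hfu : ∀ x : ℂ, f x = (conj x * u).re := fun x => by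
    conv_lhs => rw [← Complex.re_add_im x, ← mul_one (x.re : ℂ), ← Complex.real_smul,
      ← Complex.real_smul, map_add, map_smul, map_smul]
    simp [hu]
  obtain ⟨a₀, ha₀, -⟩ := hc 1
  have hu0 : u ≠ 0 := fun h0 => by
    have h1 := (hf a₀ (hA a₀ ha₀)).trans hr
    simp [hfu, h0] at h1
  obtain ⟨v, hv⟩ : ∃ v : Circle, (v : ℂ) = u / ‖u‖ :=
    ⟨⟨u / ‖u‖, mem_sphere_zero_iff_norm.2 (by simp [hu0])⟩, rfl⟩
  obtain ⟨a, ha, hac⟩ := hc v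
  have h1 := (hf a (hA a ha)).trans hr
  have hn : 0 < ‖u‖ := norm_pos_iff.2 hu0
  have key : ∀ x : ℂ, (conj x * (u / ‖u‖)).re = (conj x * u).re / ‖u‖ := fun x => by
    rw [← mul_div_assoc, Complex.div_ofReal_re]
  rw [hv, key, key] at hac
  rw [hfu, hfu] at h1
  exact absurd ((div_le_div_iff_of_pos_right hn).1 hac) h1.not_ge

/-- In a Banach lattice, bounded families of linear combinations of two elements have suprema. -/
theorem exists_isLUB_pairing [CompleteSpace F] (z : Complexification F) {A : Set ℂ}
    (hne : A.Nonempty) (hA : Bornology.IsBounded A) : ∃ m : F, IsLUB (z.pairing '' A) m := by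
  have htb : TotallyBounded A := hA.isCompact_closure.totallyBounded.subset subset_closure
  set ε : ℕ → ℝ := fun n => 1 / ((n : ℝ) + 1) with hε
  have hε0 : ∀ n, 0 < ε n := fun n => by positivity
  have hεlim : Tendsto ε atTop (𝓝 0) := tendsto_one_div_add_atTop_nhds_zero_nat
  choose t htA htfin htcov using fun n =>
    Metric.finite_approx_of_totallyBounded htb (ε n) (hε0 n)
  have htne : ∀ n, (htfin n).toFinset.Nonempty := fun n => by
    obtain ⟨a, ha⟩ := hne
    obtain ⟨y, hy, -⟩ := Set.mem_iUnion₂.1 (htcov n ha)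
    exact ⟨y, (htfin n).mem_toFinset.2 hy⟩
  set s : ℕ → F := fun n => (htfin n).toFinset.sup' (htne n) z.pairing with hs
  set u : F := |z.re| + |z.im| with hu
  have hu0 : 0 ≤ u := add_nonneg (abs_nonneg _) (abs_nonneg _)
  -- `s n` is the supremum over a finite `ε n`-net of `A`; moving to a net point costs at most `ε n
  -- • u`. This makes `s` Cauchy, with the wanted supremum as limit.
  have hle : ∀ a ∈ A, ∀ n, z.pairing a ≤ s n + ε n • u := fun a ha n => by
    obtain ⟨y, hy, hay⟩ := Set.mem_iUnion₂.1 (htcov n ha)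
    have h1 : z.pairing y ≤ s n := Finset.le_sup' _ ((htfin n).mem_toFinset.2 hy)
    have h2 : z.pairing (a - y) ≤ ε n • u := (pairing_le_norm_smul z _).trans
      (smul_le_smul_of_nonneg_right (by rw [← dist_eq_norm]; exact hay.le) hu0)
    rw [map_sub] at h2
    calc z.pairing a = z.pairing y + (z.pairing a - z.pairing y) := by abel
      _ ≤ _ := add_le_add h1 h2
  have hub : ∀ n, ∀ b, (∀ a ∈ A, z.pairing a ≤ b) → s n ≤ b := fun n b hb =>
    Finset.sup'_le _ _ fun a ha => hb a (htA n ((htfin n).mem_toFinset.1 ha))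
  have hcs : CauchySeq s := by
    refine cauchySeq_of_le_tendsto_0 (fun N => ε N * ‖u‖) (fun n m N hn hm => ?_)
      (by simpa using hεlim.mul_const ‖u‖)
    have hmono : ∀ i, N ≤ i → ε i • u ≤ ε N • u := fun i hi =>
      smul_le_smul_of_nonneg_right (one_div_le_one_div_of_le (by positivity)
        (by exact_mod_cast Nat.succ_le_succ hi)) hu0
    have hd : ∀ i j, N ≤ j → s i - s j ≤ ε N • u := fun i j hj => by
      rw [sub_le_iff_le_add']
      exact (hub i _ fun a ha => hle a ha j).trans (add_le_add le_rfl (hmono j hj))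
    have hab : |s n - s m| ≤ |ε N • u| := by
      rw [abs_of_nonneg (smul_nonneg (hε0 N).le hu0)]
      exact abs_le'.2 ⟨hd n m hm, by rw [neg_sub]; exact hd m n hn⟩
    rw [dist_eq_norm]
    refine (norm_le_norm_of_abs_le_abs hab).trans_eq ?_
    rw [norm_smul, Real.norm_of_nonneg (hε0 N).le]
  obtain ⟨m, hm⟩ := cauchySeq_tendsto_of_complete hcs
  refine ⟨m, ?_, ?_⟩
  · rintro _ ⟨a, ha, rfl⟩
    have h1 : Tendsto (fun n => s n + ε n • u) atTop (𝓝 (m + (0 : ℝ) • u)) :=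
      hm.add (hεlim.smul_const u)
    rw [zero_smul, add_zero] at h1
    exact ge_of_tendsto' h1 fun n => hle a ha n
  · exact fun b hb => le_of_tendsto' hm fun n => hub n b fun a ha => hb ⟨a, ha, rfl⟩

theorem isLUB_pairing_circle [CompleteSpace F] (z : Complexification F) :
    IsLUB (Set.range fun v : Circle => z.pairing v) z.modulus := by
  convert isLUB_modulus z using 1
  ext x
  constructor
  · rintro ⟨v, rfl⟩
    exact ⟨Complex.arg v, by rw [← pairing_exp, Circle.exp_arg]⟩
  · rintro ⟨θ, rfl⟩
    exact ⟨Circle.exp θ, pairing_exp z θ⟩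

end FunctionalCalculus

end Complexification

/-! ### Convexity estimates on the unit circle. -/

/-- The second order Taylor remainder of `v ↦ v ^ k` on the unit circle. -/
theorem exists_norm_zpow_sub_taylor_le (k : ℤ) : ∃ C : ℝ, ∀ v : Circle,
    ‖(v : ℂ) ^ k - 1 - k * (v - 1)‖ ≤ C * ‖(v : ℂ) - 1‖ ^ 2 := by
  -- This recursion has a quadratic error. As `‖v‖ = 1`, it can be run in both directions, which
  -- covers negative exponents.
  have hstep : ∀ (k : ℤ) (v : Circle), (v : ℂ) ^ (k + 1) - 1 - ((k + 1 : ℤ) : ℂ) * (v - 1) =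
      v * ((v : ℂ) ^ k - 1 - k * (v - 1)) + k * (v - 1) ^ 2 := fun k v => by
    rw [zpow_add_one₀ v.coe_ne_zero]; push_cast; ring
  induction k using Int.induction_on with
  | zero => exact ⟨0, fun v => by simp⟩
  | succ n ih =>
    obtain ⟨C, hC⟩ := ih
    refine ⟨C + |((n : ℤ) : ℝ)|, fun v => ?_⟩
    rw [hstep]
    refine (norm_add_le _ _).trans ?_
    rw [norm_mul, norm_mul, norm_pow, Circle.norm_coe, one_mul, Complex.norm_intCast, add_mul]
    exact add_le_add (hC v) le_rfl
  | pred n ih =>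
    obtain ⟨C, hC⟩ := ih
    refine ⟨C + |((-(n : ℤ) - 1 : ℤ) : ℝ)|, fun v => ?_⟩
    have h := hstep (-(n : ℤ) - 1) v
    rw [sub_add_cancel] at h
    have h2 := eq_sub_of_add_eq h.symm
    have h3 := congrArg norm h2
    rw [norm_mul, Circle.norm_coe, one_mul] at h3
    rw [h3]
    refine (norm_sub_le _ _).trans ?_
    rw [norm_mul, norm_pow, Complex.norm_intCast, add_mul]
    exact add_le_add (hC v) le_rfl

theorem Circle.norm_coe_sub_one_sq (v : Circle) : ‖(v : ℂ) - 1‖ ^ 2 = 2 * (1 - (v : ℂ).re) := by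
  have h := v.normSq_coe
  rw [Complex.normSq_apply] at h
  rw [Complex.sq_norm, Complex.normSq_apply]
  simp only [Complex.sub_re, Complex.one_re, Complex.sub_im, Complex.one_im]
  linarith

/-- The real-linear function `v ↦ Re v + i k Im v` is tangent to `v ^ k` at `1`, so the error is of
second order, and on the circle `‖v - 1‖ ^ 2 = 2 (1 - Re v)`. The constant `M` is the multiple of
the modulus that makes the functions used below convex. -/
theorem exists_norm_zpow_sub_re_sub_im_le (k : ℤ) : ∃ M : ℝ, 0 ≤ M ∧ ∀ v : Circle,
    ‖(v : ℂ) ^ k - (v : ℂ).re - Complex.I * k * (v : ℂ).im‖ ≤ M * (1 - (v : ℂ).re) := by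
  obtain ⟨C, hC⟩ := exists_norm_zpow_sub_taylor_le k
  refine ⟨2 * |C| + 1 + |(k : ℝ)|, by positivity, fun v => ?_⟩
  have hre : 0 ≤ 1 - (v : ℂ).re := by
    have := v.norm_coe_sub_one_sq
    nlinarith [sq_nonneg ‖(v : ℂ) - 1‖]
  have e : (v : ℂ) ^ k - (v : ℂ).re - Complex.I * k * (v : ℂ).im =
      ((v : ℂ) ^ k - 1 - k * (v - 1)) + (((1 - (v : ℂ).re : ℝ) : ℂ) -
        k * ((1 - (v : ℂ).re : ℝ) : ℂ)) := by
    have h := Complex.re_add_im (v : ℂ)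
    set x := (v : ℂ).re
    set y := (v : ℂ).im
    push_cast
    linear_combination -(k : ℂ) * h
  rw [e]
  refine (norm_add_le _ _).trans ?_
  have h1 : ‖(v : ℂ) ^ k - 1 - k * (v - 1)‖ ≤ 2 * |C| * (1 - (v : ℂ).re) := by
    refine (hC v).trans ?_
    rw [v.norm_coe_sub_one_sq]
    nlinarith [le_abs_self C]
  have h2 := norm_sub_le (((1 - (v : ℂ).re : ℝ) : ℂ)) (k * ((1 - (v : ℂ).re : ℝ) : ℂ))
  rw [norm_mul, Complex.norm_intCast, Complex.norm_real, Real.norm_of_nonneg hre] at h2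
  linarith

/-- The support vector at `v` of the positively homogeneous function on `ℂ` which is
`u ↦ a + Re (conj q * u ^ k)` on the unit circle. -/
noncomputable def tangentVector (k : ℤ) (a : ℝ) (q : ℂ) (v : Circle) : ℂ :=
  (((a + (conj q * (v : ℂ) ^ k).re : ℝ) : ℂ) +
    ((conj q * (Complex.I * k * (v : ℂ) ^ k)).re : ℝ) * Complex.I) * v

theorem tangentVector_add (k : ℤ) (a a' : ℝ) (q q' : ℂ) (v : Circle) :
    tangentVector k (a + a') (q + q') v = tangentVector k a q v + tangentVector k a' q' v := by
  simp only [tangentVector, map_add, add_mul, Complex.add_re]; push_cast; ring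

theorem tangentVector_smul (k : ℤ) (t a : ℝ) (q : ℂ) (v : Circle) :
    tangentVector k (t * a) (t • q) v = t • tangentVector k a q v := by
  have h : ∀ w : ℂ, (conj (t • q) * w).re = t * (conj q * w).re := fun w => by
    rw [Complex.real_smul, map_mul, Complex.conj_ofReal, mul_assoc, Complex.re_ofReal_mul]
  simp only [tangentVector, h]; push_cast; rw [Complex.real_smul]; ring

theorem tangentVector_zero_right (k : ℤ) (a : ℝ) (v : Circle) :
    tangentVector k a 0 v = a • (v : ℂ) := by
  simp [tangentVector]

/-- Rotational equivariance: rotating the argument by `w` amounts to multiplying `q` by `conj (w ^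
k)`. This is how the factor `λ` in `T z = λ z` turns into `λ ^ k`. -/
theorem conj_mul_tangentVector (k : ℤ) (a : ℝ) (q : ℂ) (w v : Circle) :
    conj (w : ℂ) * tangentVector k a q (w * v) =
      tangentVector k a (conj ((w : ℂ) ^ k) * q) v := by
  have hw : conj (w : ℂ) * w = 1 := by
    rw [mul_comm, Complex.mul_conj, Circle.normSq_coe, Complex.ofReal_one]
  simp only [tangentVector, Circle.coe_mul, mul_zpow, map_mul, Complex.conj_conj]
  rw [show conj q * ((w : ℂ) ^ k * (v : ℂ) ^ k) = (w : ℂ) ^ k * conj q * (v : ℂ) ^ k by ring,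
    show conj q * (Complex.I * k * ((w : ℂ) ^ k * (v : ℂ) ^ k)) =
      (w : ℂ) ^ k * conj q * (Complex.I * k * (v : ℂ) ^ k) by ring]
  linear_combination (((a + ((w : ℂ) ^ k * conj q * (v : ℂ) ^ k).re : ℝ) : ℂ) +
    (((w : ℂ) ^ k * conj q * (Complex.I * k * (v : ℂ) ^ k)).re : ℝ) * Complex.I) * v * hw

theorem norm_tangentVector_le (k : ℤ) (a : ℝ) (q : ℂ) (v : Circle) :
    ‖tangentVector k a q v‖ ≤ |a| + ‖q‖ + ‖q‖ * |(k : ℝ)| := by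
  rw [tangentVector, norm_mul, Circle.norm_coe, mul_one]
  refine (norm_add_le _ _).trans (add_le_add ?_ ?_)
  · rw [Complex.norm_real]
    refine (norm_add_le _ _).trans (add_le_add le_rfl ?_)
    refine (Complex.abs_re_le_norm _).trans_eq ?_
    simp [norm_zpow, Circle.norm_coe]
  · rw [norm_mul, Complex.norm_I, mul_one, Complex.norm_real]
    refine (Complex.abs_re_le_norm _).trans_eq ?_
    simp [norm_zpow, Circle.norm_coe]

theorem conj_tangentVector_mul_self_re (k : ℤ) (a : ℝ) (q : ℂ) (v : Circle) :
    (conj (tangentVector k a q v) * v).re = a + (conj q * (v : ℂ) ^ k).re := by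
  have hw : conj (v : ℂ) * v = 1 := by
    rw [mul_comm, Complex.mul_conj, Circle.normSq_coe, Complex.ofReal_one]
  rw [tangentVector, map_mul, mul_assoc, hw, mul_one]
  simp

/-- The support vectors of a function with nonnegative curvature are dominated by it. -/
theorem conj_tangentVector_mul_re_le {k : ℤ} {M : ℝ}
    (hM : ∀ v : Circle,
      ‖(v : ℂ) ^ k - (v : ℂ).re - Complex.I * k * (v : ℂ).im‖ ≤ M * (1 - (v : ℂ).re))
    {a : ℝ} {q : ℂ} (ha : M * ‖q‖ ≤ a) (v u : Circle) :
    (conj (tangentVector k a q v) * u).re ≤ a + (conj q * (u : ℂ) ^ k).re := by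
  -- After rotating `v` to `1`, right side minus left side is `a (1 - Re s)` plus the real part
  -- estimated in `h1`, hence at least `(a - M ‖q‖) (1 - Re s) ≥ 0`.
  obtain ⟨s, rfl⟩ : ∃ s, u = v * s := ⟨v⁻¹ * u, by simp⟩
  have hw : conj (v : ℂ) * v = 1 := by
    rw [mul_comm, Complex.mul_conj, Circle.normSq_coe, Complex.ofReal_one]
  have hs : (s : ℂ).re ≤ 1 := (Complex.re_le_norm _).trans_eq s.norm_coe
  have h1 : -(‖q‖ * (M * (1 - (s : ℂ).re))) ≤ (conj q * (v : ℂ) ^ k *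
      ((s : ℂ) ^ k - (s : ℂ).re - Complex.I * k * (s : ℂ).im)).re := by
    refine neg_le_of_abs_le ((Complex.abs_re_le_norm _).trans ?_)
    rw [norm_mul, norm_mul, norm_zpow, Circle.norm_coe, one_zpow, mul_one, RCLike.norm_conj]
    exact mul_le_mul_of_nonneg_left (hM s) (norm_nonneg _)
  have h2 : (conj (tangentVector k a q v) * (v * s : Circle)).re =
      (a + (conj q * (v : ℂ) ^ k).re) * (s : ℂ).re +
        (conj q * (v : ℂ) ^ k * (Complex.I * k)).re * (s : ℂ).im := by
    rw [tangentVector, map_mul, Circle.coe_mul, mul_assoc, ← mul_assoc (conj (v : ℂ)), hw, one_mul,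
      show conj q * (Complex.I * k * (v : ℂ) ^ k) = conj q * (v : ℂ) ^ k * (Complex.I * k) by ring]
    simp
    ring
  have h3 : (conj q * ((v * s : Circle) : ℂ) ^ k).re = (conj q * (v : ℂ) ^ k *
      ((s : ℂ) ^ k - (s : ℂ).re - Complex.I * k * (s : ℂ).im)).re +
      ((conj q * (v : ℂ) ^ k).re * (s : ℂ).re +
        (conj q * (v : ℂ) ^ k * (Complex.I * k)).re * (s : ℂ).im) := by
    rw [Circle.coe_mul, mul_zpow, ← Complex.re_mul_ofReal, ← Complex.re_mul_ofReal,
      ← Complex.add_re, ← Complex.add_re]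
    congr 1
    ring
  rw [h2, h3]
  nlinarith

namespace Complexification

/-! ### The element `|z| (sgn z) ^ k` and positive operators. -/

section Phase

variable {F : Type*} [NormedAddCommGroup F] [Lattice F] [HasSolidNorm F] [IsOrderedAddMonoid F]
  [NormedSpace ℝ F] [IsOrderedModule ℝ F] [CompleteSpace F]

/-- The element `y = |z| (sgn z) ^ k`, characterized through the support functions of the
sublinear functions `u ↦ M ‖q‖ |u| + Re (conj q * |u| (sgn u) ^ k)`. -/
theorem exists_isLUB_pairing_tangentVector (z : Complexification F) (k : ℤ) :
    ∃ M : ℝ, 0 ≤ M ∧ ∃ y : Complexification F, ∀ q : ℂ,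
      IsLUB (Set.range fun v : Circle => z.pairing (tangentVector k (M * ‖q‖) q v))
        (y.pairing q + (M * ‖q‖) • z.modulus) := by
  obtain ⟨M, hM0, hM⟩ := exists_norm_zpow_sub_re_sub_im_le k
  have hex : ∀ (a : ℝ) (q : ℂ), ∃ m : F,
      IsLUB (Set.range fun v : Circle => z.pairing (tangentVector k a q v)) m := fun a q => by
    have h := exists_isLUB_pairing z (Set.range_nonempty (tangentVector k a q))
      (isBounded_iff_forall_norm_le.2 ⟨|a| + ‖q‖ + ‖q‖ * |(k : ℝ)|, by
        rintro _ ⟨v, rfl⟩; exact norm_tangentVector_le k a q v⟩)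
    rwa [← Set.range_comp] at h
  choose Φ hΦ using hex
  have hle : ∀ a q v, z.pairing (tangentVector k a q v) ≤ Φ a q := fun a q v =>
    (hΦ a q).1 ⟨v, rfl⟩
  have hle' : ∀ {a q b}, (∀ v, z.pairing (tangentVector k a q v) ≤ b) → Φ a q ≤ b :=
    fun h => (hΦ _ _).2 (by rintro _ ⟨v, rfl⟩; exact h v)
  have hadd : ∀ {a a' : ℝ} {q q' : ℂ}, M * ‖q‖ ≤ a → M * ‖q'‖ ≤ a' →
      Φ (a + a') (q + q') = Φ a q + Φ a' q' := fun {a a' q q'} ha ha' => by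
    refine le_antisymm (hle' fun v => ?_) ?_
    · rw [tangentVector_add, map_add]
      exact add_le_add (hle a q v) (hle a' q' v)
    -- A sum of two support vectors at different points is still dominated by the sum of the two
    -- convex functions, so it lies in the closed convex hull of the support vectors of that sum.
    -- The suprema over `v` and `v'` are then taken one after the other.
    · have h : ∀ v v', z.pairing (tangentVector k a q v) + z.pairing (tangentVector k a' q' v') ≤
          Φ (a + a') (q + q') := fun v v' => by
        rw [← map_add]
        refine pairing_le_of_forall_circle (A := Set.range (tangentVector k (a + a') (q + q')))
          (by rintro _ ⟨v, rfl⟩; exact hle _ _ v) fun u => ⟨_, ⟨u, rfl⟩, ?_⟩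
        rw [conj_tangentVector_mul_self_re, map_add, map_add, add_mul, add_mul, Complex.add_re,
          Complex.add_re]
        have h1 := conj_tangentVector_mul_re_le hM ha v u
        have h2 := conj_tangentVector_mul_re_le hM ha' v' u
        linarith
      rw [← le_sub_iff_add_le]
      refine hle' fun v => ?_
      rw [le_sub_comm]
      refine hle' fun v' => ?_
      rw [le_sub_iff_add_le']
      exact h v v'
  have hsmul : ∀ {t : ℝ} (a : ℝ) (q : ℂ), 0 < t → Φ (t * a) (t • q) = t • Φ a q := by
    have h : ∀ {t : ℝ} (a : ℝ) (q : ℂ), 0 < t → Φ (t * a) (t • q) ≤ t • Φ a q :=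
      fun a q ht => hle' fun v => by
        rw [tangentVector_smul, map_smul]
        exact smul_le_smul_of_nonneg_left (hle a q v) ht.le
    refine fun {t} a q ht => le_antisymm (h a q ht) ?_
    have h1 := smul_le_smul_of_nonneg_left (h (t * a) (t • q) (inv_pos.2 ht)) ht.le
    rwa [inv_mul_cancel_left₀ ht.ne', inv_smul_smul₀ ht.ne', smul_inv_smul₀ ht.ne'] at h1
  have hzero : ∀ {a : ℝ}, 0 ≤ a → Φ a 0 = a • z.modulus := by
    intro a ha
    rcases ha.eq_or_lt with rfl | ha
    · refine (hΦ 0 0).unique ?_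
      simp only [tangentVector_zero_right, zero_smul, map_zero, Set.range_const]
      exact isLUB_singleton
    · have h1 : Φ 1 0 = z.modulus := (hΦ 1 0).unique <| by
        simpa only [tangentVector_zero_right, one_smul] using isLUB_pairing_circle z
      rw [← h1, ← hsmul 1 0 ha, mul_one, smul_zero]
  -- Removing the convexifying multiple of `|z|` leaves a real-linear function of `q`, which
  -- determines `y` by its values at `1` and `i`. By `hΦg`, any larger `a` only adds a multiple of
  -- `|z|`.
  set g : ℂ → F := fun q => Φ (M * ‖q‖) q - (M * ‖q‖) • z.modulus with hg
  have hΦg : ∀ {a : ℝ} {q : ℂ}, M * ‖q‖ ≤ a → Φ a q = g q + a • z.modulus := fun {a q} ha => by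
    have h1 := hadd (le_refl (M * ‖q‖)) (a' := a - M * ‖q‖) (q' := 0) (by simpa using ha)
    rw [add_sub_cancel, add_zero, hzero (sub_nonneg.2 ha)] at h1
    rw [h1, hg]
    module
  have gadd : ∀ q q', g (q + q') = g q + g q' := fun q q' => by
    have h1 := hadd (le_refl (M * ‖q‖)) (le_refl (M * ‖q'‖))
    have hn : M * ‖q + q'‖ ≤ M * ‖q‖ + M * ‖q'‖ := by
      rw [← mul_add]; exact mul_le_mul_of_nonneg_left (norm_add_le _ _) hM0
    rw [hΦg hn, hΦg le_rfl, hΦg le_rfl] at h1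
    have h2 : g (q + q') = g q + (M * ‖q‖) • z.modulus + (g q' + (M * ‖q'‖) • z.modulus) -
      (M * ‖q‖ + M * ‖q'‖) • z.modulus := eq_sub_of_add_eq h1
    rw [h2]
    module
  have gzero : g 0 = 0 := by
    have := gadd 0 0
    rwa [add_zero, left_eq_add] at this
  have gneg : ∀ q, g (-q) = -g q := fun q => by
    have := gadd (-q) q
    rw [neg_add_cancel, gzero] at this
    exact eq_neg_of_add_eq_zero_left this.symm
  have gpos : ∀ (t : ℝ) (q : ℂ), 0 < t → g (t • q) = t • g q := fun t q ht => by
    have h1 : M * ‖t • q‖ = t * (M * ‖q‖) := by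
      rw [norm_smul, Real.norm_of_nonneg ht.le]; ring
    simp only [hg]
    rw [h1, hsmul _ _ ht, smul_sub, mul_smul t]
  have gsmul : ∀ (t : ℝ) (q : ℂ), g (t • q) = t • g q := fun t q => by
    rcases lt_trichotomy t 0 with ht | rfl | ht
    · have h1 := gpos (-t) q (neg_pos.2 ht)
      rw [neg_smul, neg_smul, gneg] at h1
      exact neg_injective h1
    · rw [zero_smul, zero_smul, gzero]
    · exact gpos t q ht
  refine ⟨M, hM0, ⟨g 1, g Complex.I⟩, fun q => ?_⟩
  have hq : pairing (⟨g 1, g Complex.I⟩ : Complexification F) q = g q := by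
    rw [pairing_apply, ← gsmul, ← gsmul, ← gadd, Complex.real_smul, Complex.real_smul, mul_one,
      Complex.re_add_im]
  rw [hq, ← hΦg le_rfl]
  exact hΦ _ _

theorem modulus_le_of_forall_circle {z : Complexification F} {b : F}
    (h : ∀ q : Circle, z.pairing q ≤ b) : z.modulus ≤ b :=
  (isLUB_pairing_circle z).2 (by rintro _ ⟨v, rfl⟩; exact h v)

theorem pairing_le_modulus (z : Complexification F) (q : Circle) : z.pairing q ≤ z.modulus :=
  (isLUB_pairing_circle z).1 ⟨q, rfl⟩

/-- The entrywise action of a real operator on the complexification. -/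
def IsEntrywise (T : Complexification F →L[ℂ] Complexification F) (S : F →ₗ[ℝ] F) : Prop :=
  Monotone S ∧ ∀ z, T z = ⟨S z.re, S z.im⟩

/-- Real elements are differences of positive ones, so `T` preserves the real part; complex
linearity does the rest. -/
theorem IsPositiveOperator.exists_isEntrywise {T : Complexification F →L[ℂ] Complexification F}
    (hT : IsPositiveOperator T) : ∃ S : F →ₗ[ℝ] F, IsEntrywise T S := by
  have hpos : ∀ x : F, 0 ≤ x → (T ⟨x, 0⟩).im = 0 ∧ 0 ≤ (T ⟨x, 0⟩).re := fun x hx =>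
    (hT ⟨x, 0⟩ ⟨rfl, rfl, hx⟩).2
  have hadd : ∀ x y : F, T ⟨x + y, 0⟩ = T ⟨x, 0⟩ + T ⟨y, 0⟩ := fun x y => by
    rw [← map_add]; congr 1; ext <;> simp
  have him : ∀ x : F, (T ⟨x, 0⟩).im = 0 := fun x => by
    have h := congrArg Complexification.im (hadd x x⁻)
    rw [← sub_eq_iff_eq_add.1 (posPart_sub_negPart x), add_im, (hpos _ (posPart_nonneg x)).1,
      (hpos _ (negPart_nonneg x)).1, add_zero] at h
    exact h.symm
  have hsmul : ∀ (r : ℝ) (x : F), T ⟨r • x, 0⟩ = (r : ℂ) • T ⟨x, 0⟩ := fun r x => by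
    rw [← map_smul]; congr 1; ext <;> simp [-Complex.coe_smul]
  let S : F →ₗ[ℝ] F :=
    { toFun := fun x => (T ⟨x, 0⟩).re
      map_add' := fun x y => by rw [hadd, add_re]
      map_smul' := fun r x => by rw [hsmul]; simp [-Complex.coe_smul] }
  have hS : ∀ x, S x = (T ⟨x, 0⟩).re := fun x => rfl
  refine ⟨S, fun x y hxy => ?_, fun z => ?_⟩
  · rw [← sub_nonneg, ← map_sub]
    exact (hpos _ (sub_nonneg.2 hxy)).2
  · have e : z = ⟨z.re, 0⟩ + Complex.I • ⟨z.im, 0⟩ := by ext <;> simp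
    conv_lhs => rw [e]
    rw [map_add, map_smul]
    ext <;> simp [hS, him]

namespace IsEntrywise

variable {T : Complexification F →L[ℂ] Complexification F} {S : F →ₗ[ℝ] F}

theorem pow (h : IsEntrywise T S) (n : ℕ) : IsEntrywise (T ^ n) (S ^ n) := by
  induction n with
  | zero => exact ⟨fun _ _ h => h, fun _ => rfl⟩
  | succ n ih =>
    refine ⟨?_, fun z => ?_⟩
    · rw [pow_succ']
      exact h.1.comp ih.1
    · rw [pow_succ', pow_succ', mul_apply_eq_comp, ih.2, h.2]
      rfl

theorem pairing_apply (h : IsEntrywise T S) (z : Complexification F) (q : ℂ) :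
    (T z).pairing q = S (z.pairing q) := by
  rw [h.2, Complexification.pairing_apply, Complexification.pairing_apply, map_add, map_smul,
    map_smul]

theorem modulus_apply_le (h : IsEntrywise T S) (z : Complexification F) :
    (T z).modulus ≤ S z.modulus :=
  modulus_le_of_forall_circle fun q => by
    rw [h.pairing_apply]; exact h.1 (pairing_le_modulus z q)

theorem norm_apply_le (h : IsEntrywise T S) (x : F) : ‖S x‖ ≤ ‖T‖ * ‖x‖ := by
  have h1 : ‖S x‖ ≤ ‖T ⟨x, 0⟩‖ := by simpa [h.2] using norm_re_le (T ⟨x, 0⟩)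
  have h2 := norm_le_add (⟨x, 0⟩ : Complexification F)
  simp only [norm_zero, add_zero] at h2
  exact h1.trans ((T.le_opNorm _).trans (mul_le_mul_of_nonneg_left h2 (norm_nonneg T)))

end IsEntrywise

/-- For an eigenvector `z` with unimodular eigenvalue `lam`, the element `y = |z| (sgn z) ^ k` is
an approximate eigenvector for `lam ^ k` up to the defect of `|z|` from being fixed. -/
theorem exists_modulus_apply_sub_zpow_smul_le (z : Complexification F) (k : ℤ) :
    ∃ M : ℝ, 0 ≤ M ∧ ∃ y : Complexification F, z.modulus ≤ y.modulus ∧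
      ∀ (T : Complexification F →L[ℂ] Complexification F) (S : F →ₗ[ℝ] F), IsEntrywise T S →
        ∀ lam : Circle, T z = (lam : ℂ) • z →
          ((lam : ℂ) ^ k • y - T y).modulus ≤ M • (S z.modulus - z.modulus) := by
  obtain ⟨M, hM0, y, hy⟩ := exists_isLUB_pairing_tangentVector z k
  refine ⟨M, hM0, y, ?_, fun T S hTS lam hz => ?_⟩
  -- With `q = v ^ k` the function has value `M + 1` and derivative `0` at `v`, so the support
  -- vector there is `(M + 1) v`. Taking the supremum over `v` gives `(M + 1) |z| ≤ |y| + M |z|`.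
  · have h1 : z.modulus ≤ (M + 1)⁻¹ • (y.modulus + M • z.modulus) :=
      modulus_le_of_forall_circle fun v => by
        rw [le_inv_smul_iff_of_pos (by positivity), ← map_smul]
        have h2 := (hy ((v : ℂ) ^ k)).1 ⟨v, rfl⟩
        have h3 := pairing_le_modulus y (v ^ k)
        have h4 : conj ((v : ℂ) ^ k) * (v : ℂ) ^ k = 1 := by
          rw [← Circle.coe_zpow, mul_comm, Complex.mul_conj, Circle.normSq_coe, Complex.ofReal_one]
        have h5 : tangentVector k (M * ‖(v : ℂ) ^ k‖) ((v : ℂ) ^ k) v = (M + 1) • (v : ℂ) := by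
          rw [tangentVector, show conj ((v : ℂ) ^ k) * (Complex.I * k * (v : ℂ) ^ k) =
            conj ((v : ℂ) ^ k) * (v : ℂ) ^ k * (Complex.I * k) by ring, h4, ← Circle.coe_zpow,
            Circle.norm_coe]
          simp
        simp only [h5] at h2
        rw [← Circle.coe_zpow, Circle.norm_coe, mul_one] at h2
        exact h2.trans (add_le_add h3 le_rfl)
    rw [le_inv_smul_iff_of_pos (by positivity), add_smul, one_smul, add_comm] at h1
    exact le_of_add_le_add_right h1
  · refine modulus_le_of_forall_circle fun q => ?_
    -- Jensen's inequality: by equivariance each form at `z` with parameter `conj (lam ^ k) * q`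
    -- equals a form at `lam • z = T z` with parameter `q`, that is, `S` of a form at `z`, and `S`
    -- is monotone.
    have h1 : _ ≤ S (y.pairing q + M • z.modulus) := (hy (conj ((lam : ℂ) ^ k) * q)).2 (by
      rintro _ ⟨v, rfl⟩
      have h2 := (hy q).1 ⟨lam * v, rfl⟩
      rw [Circle.norm_coe, mul_one] at h2
      have h3 := hTS.1 h2
      have h4 : ‖conj ((lam : ℂ) ^ k) * q‖ = 1 := by simp [norm_zpow, Circle.norm_coe]
      rw [← hTS.pairing_apply, hz, pairing_smul, conj_mul_tangentVector] at h3
      simpa only [h4, mul_one] using h3)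
    have h4 : ‖conj ((lam : ℂ) ^ k) * q‖ = 1 := by simp [norm_zpow, Circle.norm_coe]
    rw [h4, mul_one, ← pairing_smul, map_add, map_smul, ← hTS.pairing_apply] at h1
    rw [pairing_sub, smul_sub, sub_le_sub_iff, add_comm (M • S z.modulus), add_comm]
    rw [add_comm]
    exact h1

end Phase

end Complexification

/-! ### Weak-star limits and norming functionals. -/

/-- A series all of whose unimodular multiples have bounded partial sums converges weak-star in the
bidual. -/
theorem exists_tendsto_sum_bidual {X : Type*} [NormedAddCommGroup X] [NormedSpace ℂ X]
    {d : ℕ → X} {C : ℝ}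
    (hC : ∀ (ε : ℕ → ℂ), (∀ n, ‖ε n‖ = 1) → ∀ N, ‖∑ n ∈ Finset.range N, ε n • d n‖ ≤ C) :
    ∃ w : StrongDual ℂ (StrongDual ℂ X), ∀ ψ : StrongDual ℂ X,
      Tendsto (fun N => ψ (∑ n ∈ Finset.range N, d n)) atTop (𝓝 (w ψ)) := by
  have hbd : ∀ (ψ : StrongDual ℂ X) N, ∑ n ∈ Finset.range N, ‖ψ (d n)‖ ≤ C * ‖ψ‖ := fun ψ N => by
    -- Aligning the phases of `ψ (d n)` turns the bound on unimodular multiples into absolute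
    -- summability.
    choose ε hε1 hε using fun n => RCLike.exists_norm_eq_mul_self (ψ (d n))
    have h1 : ((∑ n ∈ Finset.range N, ‖ψ (d n)‖ : ℝ) : ℂ) =
        ψ (∑ n ∈ Finset.range N, ε n • d n) := by
      push_cast
      rw [map_sum]
      exact Finset.sum_congr rfl fun n _ => by rw [map_smul, smul_eq_mul]; exact hε n
    have h2 := congrArg norm h1
    rw [Complex.norm_real, Real.norm_of_nonneg (Finset.sum_nonneg fun _ _ => norm_nonneg _)] at h2
    rw [h2, mul_comm]
    exact (ψ.le_opNorm _).trans (mul_le_mul_of_nonneg_left (hC ε hε1 N) (norm_nonneg ψ))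
  have hsum : ∀ ψ : StrongDual ℂ X, Summable fun n => ‖ψ (d n)‖ := fun ψ =>
    summable_of_sum_range_le (fun _ => norm_nonneg _) (hbd ψ)
  let w₀ : StrongDual ℂ X →ₗ[ℂ] ℂ :=
    { toFun := fun ψ => ∑' n, ψ (d n)
      map_add' := fun ψ χ => (hsum ψ).of_norm.tsum_add (hsum χ).of_norm
      map_smul' := fun c ψ => (hsum ψ).of_norm.tsum_const_smul c }
  refine ⟨w₀.mkContinuous C fun ψ => ?_, fun ψ => ?_⟩
  · exact (norm_tsum_le_tsum_norm (hsum ψ)).trans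
      ((hsum ψ).tsum_le_of_sum_range_le (hbd ψ))
  · simp only [map_sum]
    exact (hsum ψ).of_norm.hasSum.tendsto_sum_nat

theorem exists_eq_and_le_of_sublinear {E : Type*} [AddCommGroup E] [Module ℝ E] {N : E → ℝ}
    (N_hom : ∀ c : ℝ, 0 < c → ∀ x, N (c • x) = c * N x) (N_add : ∀ x y, N (x + y) ≤ N x + N y)
    {x : E} (hx : x ≠ 0) : ∃ g : E →ₗ[ℝ] ℝ, g x = N x ∧ ∀ y, g y ≤ N y := by
  have N_0 : N 0 = 0 := by
    have := N_hom 2 two_pos 0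
    rw [smul_zero] at this
    linarith
  obtain ⟨g, hg, hgN⟩ := exists_extension_of_le_sublinear
    (LinearPMap.mkSpanSingleton (σ := RingHom.id ℝ) x (N x) hx) N N_hom N_add (by
      rintro ⟨y, hy⟩
      obtain ⟨c, rfl⟩ := Submodule.mem_span_singleton.1 hy
      rw [LinearPMap.mkSpanSingleton'_apply, RingHom.id_apply, smul_eq_mul]
      rcases lt_trichotomy c 0 with hc | rfl | hc
      · have h1 := N_hom (-c) (neg_pos.2 hc) x
        have h2 := N_add (c • x) (-c • x)
        rw [neg_smul, add_neg_cancel, N_0] at h2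
        rw [neg_smul] at h1
        change c * N x ≤ N (c • x)
        linarith
      · simp [N_0]
      · exact (N_hom c hc x).ge)
  refine ⟨g, ?_, hgN⟩
  have h := hg ⟨x, Submodule.mem_span_singleton_self x⟩
  exact h.trans (LinearPMap.mkSpanSingleton'_apply_self _ _ _ _)

/-- Hahn–Banach for the sublinear function `y ↦ ‖y⁺‖`: it vanishes on the negative cone, so a
functional below it is monotone. -/
theorem exists_monotone_functional {F : Type*} [NormedAddCommGroup F] [Lattice F] [HasSolidNorm F]
    [IsOrderedAddMonoid F] [NormedSpace ℝ F] [IsOrderedModule ℝ F] {x : F} (hx0 : 0 ≤ x)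
    (hx : x ≠ 0) : ∃ φ : F →ₗ[ℝ] ℝ, Monotone φ ∧ φ x = ‖x‖ ∧ ∀ y, φ y ≤ ‖y‖ := by
  have hle : ∀ {a b : F}, 0 ≤ a → a ≤ b → ‖a‖ ≤ ‖b‖ := fun ha hab =>
    norm_le_norm_of_abs_le_abs (by rwa [abs_of_nonneg ha, abs_of_nonneg (ha.trans hab)])
  obtain ⟨φ, hφx, hφ⟩ := exists_eq_and_le_of_sublinear (N := fun y : F => ‖y⁺‖)
    (fun c hc y => by
      have h : (c • y)⁺ = c • y⁺ := by
        refine le_antisymm (sup_le (smul_le_smul_of_nonneg_left (le_posPart y) hc.le)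
          (smul_nonneg hc.le (posPart_nonneg y))) ?_
        rw [← le_inv_smul_iff_of_pos hc]
        refine sup_le ?_ (smul_nonneg (inv_pos.2 hc).le (posPart_nonneg _))
        rw [le_inv_smul_iff_of_pos hc]
        exact le_posPart _
      simp only [h, norm_smul, Real.norm_of_nonneg hc.le])
    (fun a b => (hle (posPart_nonneg _) (sup_le (add_le_add (le_posPart a) (le_posPart b))
      (add_nonneg (posPart_nonneg a) (posPart_nonneg b)))).trans (norm_add_le _ _)) hx
  refine ⟨φ, fun a b hab => ?_, by rw [hφx, posPart_eq_self.2 hx0], fun y => (hφ y).trans ?_⟩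
  · have h := hφ (a - b)
    rw [posPart_eq_zero.2 (sub_nonpos.2 hab), norm_zero, map_sub] at h
    linarith
  · rw [← norm_abs_eq_norm y]
    exact hle (posPart_nonneg y) (sup_le (le_abs_self y) (abs_nonneg y))

namespace Complexification

variable {F : Type*} [NormedAddCommGroup F] [Lattice F] [HasSolidNorm F] [IsOrderedAddMonoid F]
  [NormedSpace ℝ F] [IsOrderedModule ℝ F] [CompleteSpace F]

theorem modulus_zero : (0 : Complexification F).modulus = 0 := by
  have h := modulus_le_abs_add_abs (0 : Complexification F)
  simp only [zero_re, zero_im, abs_zero, add_zero] at h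
  exact le_antisymm h (modulus_nonneg _)

/-- Multiplying a monotone functional on the real part by the conjugate phase of `y`. -/
theorem exists_strongDual_apply_eq_modulus {φ : F →ₗ[ℝ] ℝ} (hφ : Monotone φ) {C : ℝ}
    (hC : ∀ x, φ x ≤ C * ‖x‖) {y : Complexification F} (hy : y ≠ 0) :
    ∃ ψ : StrongDual ℂ (Complexification F), ψ y = φ y.modulus ∧ ∀ x, ‖ψ x‖ ≤ φ x.modulus := by
  let p : Seminorm ℂ (Complexification F) := Seminorm.ofSMulLE (fun x => φ x.modulus)
    (by rw [modulus_zero, map_zero])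
    (fun x x' => by rw [← map_add]; exact hφ (modulus_add_le x x'))
    (fun c x => by rw [← smul_eq_mul, ← map_smul]; exact hφ (modulus_smul_le c x))
  have hp : ∀ x, p x = φ x.modulus := fun x => rfl
  let f := LinearPMap.mkSpanSingleton (σ := RingHom.id ℂ) y ((φ y.modulus : ℝ) : ℂ) hy
  obtain ⟨ψ, hψ, hψp⟩ := Module.Dual.exists_extension_of_le_seminorm f.domain f.toFun (p := p) (by
    rintro ⟨x, hx⟩
    obtain ⟨c, rfl⟩ := Submodule.mem_span_singleton.1 hx
    change ‖f ⟨c • y, hx⟩‖ ≤ p (c • y)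
    rw [LinearPMap.mkSpanSingleton'_apply, map_smul_eq_mul, RingHom.id_apply, norm_smul,
      Complex.norm_real, ← hp, Real.norm_of_nonneg (apply_nonneg p y)])
  refine ⟨ψ.mkContinuous C fun x => (hψp x).trans (hC _), ?_, hψp⟩
  have h := hψ ⟨y, Submodule.mem_span_singleton_self y⟩
  exact h.trans (LinearPMap.mkSpanSingleton'_apply_self _ _ _ _)

/-! ### The eigenvector in the bidual. -/

theorem zpow_mem_pointSpectrum_bidual {T : Complexification F →L[ℂ] Complexification F}
    {S : F →ₗ[ℝ] F} (hTS : IsEntrywise T S) {lam : Circle} {z : Complexification F} (hz0 : z ≠ 0)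
    (hz : T z = (lam : ℂ) • z) {C : ℝ} (hC : ∀ n : ℕ, ‖(S ^ n) z.modulus‖ ≤ C) (k : ℤ) :
    (lam : ℂ) ^ k ∈ pointSpectrum (dualOperator (dualOperator T)) := by
  obtain ⟨M, hM0, y, hzy, hy⟩ := exists_modulus_apply_sub_zpow_smul_le z k
  specialize hy T S hTS lam hz
  obtain ⟨μ, hμ⟩ : ∃ μ : Circle, (μ : ℂ) = (lam : ℂ) ^ k := ⟨lam ^ k, by simp⟩
  rw [← hμ] at hy ⊢
  set m := z.modulus with hm
  have hm0 : m ≠ 0 := fun h => hz0 (norm_eq_zero.1 (by rw [norm_def, ← hm, h, norm_zero]))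
  have hzS : m ≤ S m := by
    have h1 := hTS.modulus_apply_le z
    have h2 := modulus_smul_le ((lam⁻¹ : Circle) : ℂ) (T z)
    rw [hz, smul_smul, ← Circle.coe_mul, inv_mul_cancel, Circle.coe_one, one_smul, Circle.norm_coe,
      one_smul, ← hz] at h2
    exact h2.trans h1
  set W : ℕ → Complexification F := fun n => ((μ⁻¹ ^ n : Circle) : ℂ) • (T ^ n) y with hW
  set d : ℕ → Complexification F := fun n => W (n + 1) - W n with hd
  have hTW : ∀ n, T (W n) = (μ : ℂ) • W (n + 1) := fun n => by
    simp only [hW]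
    rw [map_smul, smul_smul, ← Circle.coe_mul, pow_succ' μ⁻¹, mul_inv_cancel_left, pow_succ' T,
      mul_apply_eq_comp]
  have hdm : ∀ n, (d n).modulus ≤ M • ((S ^ (n + 1)) m - (S ^ n) m) := fun n => by
    have e : d n = (-((μ⁻¹ ^ (n + 1) : Circle) : ℂ)) • (T ^ n) ((μ : ℂ) • y - T y) := by
      have h1 : (T ^ (n + 1)) y = (T ^ n) (T y) := by rw [pow_succ]; rfl
      have h2 : ((μ⁻¹ ^ (n + 1) : Circle) : ℂ) * μ = ((μ⁻¹ ^ n : Circle) : ℂ) := by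
        rw [← Circle.coe_mul, pow_succ, inv_mul_cancel_right]
      simp only [hd, hW]
      rw [map_sub, map_smul, h1, ← h2, mul_smul]
      module
    have h1 := modulus_smul_le (-((μ⁻¹ ^ (n + 1) : Circle) : ℂ)) ((T ^ n) ((μ : ℂ) • y - T y))
    rw [← e, norm_neg, Circle.norm_coe, one_smul] at h1
    refine (h1.trans ((hTS.pow n).modulus_apply_le _)).trans (((hTS.pow n).1 hy).trans_eq ?_)
    rw [map_smul, map_sub, pow_succ]
    rfl
  -- The bounds on `|d n|` telescope and do not see the phases `ε n`.
  have hsum : ∀ ε : ℕ → ℂ, (∀ n, ‖ε n‖ = 1) → ∀ N,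
      (∑ n ∈ Finset.range N, ε n • d n).modulus ≤ M • ((S ^ N) m - m) := fun ε hε N => by
    induction N with
    | zero => simp [modulus_zero]
    | succ N ih =>
      rw [Finset.sum_range_succ]
      have h1 := modulus_smul_le (ε N) (d N)
      rw [hε, one_smul] at h1
      refine (modulus_add_le _ _).trans ((add_le_add ih (h1.trans (hdm N))).trans_eq ?_)
      module
  obtain ⟨w₀, hw₀⟩ := exists_tendsto_sum_bidual (d := d) (C := M * C) fun ε hε N => by
    have h1 : (∑ n ∈ Finset.range N, ε n • d n).modulus ≤ M • (S ^ N) m :=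
      (hsum ε hε N).trans (smul_le_smul_of_nonneg_left (sub_le_self _ (modulus_nonneg z)) hM0)
    rw [norm_def]
    refine (norm_le_norm_of_le (modulus_nonneg _) h1).trans ?_
    rw [norm_smul, Real.norm_of_nonneg hM0]
    exact mul_le_mul_of_nonneg_left (hC N) hM0
  set w : StrongDual ℂ (StrongDual ℂ (Complexification F)) :=
    w₀ + NormedSpace.inclusionInDoubleDual ℂ _ y with hw
  have hsumW : ∀ N, ∑ n ∈ Finset.range N, d n + y = W N := fun N => by
    rw [Finset.sum_range_sub]; simp [hW]
  have hwlim : ∀ ψ : StrongDual ℂ (Complexification F),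
      Tendsto (fun N => ψ (W N)) atTop (𝓝 (w ψ)) := fun ψ => by
    have h1 := (hw₀ ψ).add_const (ψ y)
    simp only [← map_add, hsumW] at h1
    exact h1
  -- Both sides at `ψ` are the limit of `ψ (T (W N)) = μ ψ (W (N + 1))`.
  have heig : dualOperator (dualOperator T) w = (μ : ℂ) • w := by
    ext ψ
    have h1 := hwlim (dualOperator T ψ)
    have h2 : Tendsto (fun N => ψ (T (W N))) atTop (𝓝 ((μ : ℂ) * w ψ)) := by
      simp only [hTW, map_smul, smul_eq_mul]
      exact ((tendsto_add_atTop_iff_nat 1).2 (hwlim ψ)).const_mul _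
    exact tendsto_nhds_unique h1 h2
  refine Module.End.hasEigenvalue_of_hasEigenvector (x := w)
    ⟨Module.End.mem_eigenspace_iff.2 heig, fun hw0 => ?_⟩
  obtain ⟨φ, hφ, hφm, hφn⟩ := exists_monotone_functional (modulus_nonneg z) hm0
  set a : ℕ → ℝ := fun n => φ ((S ^ n) m) with ha
  have ha_mono : Monotone a := monotone_nat_of_le_succ fun n => hφ <| by
    rw [pow_succ]; exact (hTS.pow n).1 hzS
  have ha_bdd : BddAbove (Set.range a) := ⟨C, by rintro _ ⟨n, rfl⟩; exact (hφn _).trans (hC n)⟩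
  have hA : 0 < ‖m‖ := norm_pos_iff.2 hm0
  have ha0 : a 0 = ‖m‖ := hφm
  -- The sequence `a` increases to a finite supremum; `j` is chosen so that all later growth,
  -- multiplied by `M`, is at most `‖m‖ / 2`.
  obtain ⟨j, hj⟩ := exists_lt_of_lt_ciSup (sub_lt_self (⨆ n, a n)
    (show 0 < ‖m‖ / (2 * (M + 1)) by positivity))
  have hj' : ∀ N, M * (a N - a j) ≤ ‖m‖ / 2 := fun N => by
    have h1 : a N - a j ≤ ‖m‖ / (2 * (M + 1)) := by linarith [le_ciSup ha_bdd N]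
    have h2 : (M + 1) * (‖m‖ / (2 * (M + 1))) = ‖m‖ / 2 := by field_simp
    have h3 : 0 ≤ ‖m‖ / (2 * (M + 1)) := by positivity
    nlinarith [mul_le_mul_of_nonneg_left h1 hM0]
  have hy0 : y ≠ 0 := by
    rintro rfl
    rw [modulus_zero] at hzy
    exact hm0 (le_antisymm hzy (modulus_nonneg z))
  obtain ⟨ψ, hψy, hψ⟩ := exists_strongDual_apply_eq_modulus (φ := φ.comp (S ^ j))
    (hφ.comp (hTS.pow j).1) (C := ‖T ^ j‖)
    (fun x => (hφn _).trans ((hTS.pow j).norm_apply_le x)) hy0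
  -- `W N` is `y` plus the sum of increments. On `y` the functional has size at least `φ (S ^ j m) ≥
  -- ‖m‖`, on the sum at most `M (a (j + N) - a j) ≤ ‖m‖ / 2`; so the limit `w ψ` is nonzero.
  have hlow : ∀ N, ‖m‖ / 2 ≤ ‖ψ (W N)‖ := fun N => by
    have h1 : ‖ψ (∑ n ∈ Finset.range N, d n)‖ ≤ ‖m‖ / 2 := by
      have h2 := hsum (fun _ => 1) (fun _ => norm_one) N
      simp only [one_smul] at h2
      refine ((hψ _).trans ((hφ.comp (hTS.pow j).1) h2)).trans (le_trans (le_of_eq ?_) (hj' (j + N)))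
      simp only [ha, Function.comp_apply, map_smul, map_sub, smul_eq_mul, pow_add,
        Module.End.mul_apply]
    have h3 : ‖m‖ ≤ ‖ψ y‖ := by
      rw [hψy, Complex.norm_real]
      refine le_trans ?_ (le_abs_self _)
      rw [← ha0]
      exact (ha_mono (Nat.zero_le j)).trans (hφ ((hTS.pow j).1 hzy))
    rw [← hsumW, map_add, add_comm]
    have h4 := norm_sub_le (ψ y + ψ (∑ n ∈ Finset.range N, d n)) (ψ (∑ n ∈ Finset.range N, d n))
    rw [add_sub_cancel_right] at h4
    linarith
  have h1 := ge_of_tendsto' (hwlim ψ).norm hlow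
  rw [hw0] at h1
  simp only [zero_apply, norm_zero] at h1
  linarith

end Complexification

/-! ### Passage to the spectrum of `T`, and conclusion. -/

theorem pointSpectrum_bidual_subset_spectrum {X : Type*} [NormedAddCommGroup X] [NormedSpace ℂ X]
    (T : X →L[ℂ] X) : pointSpectrum (dualOperator (dualOperator T)) ⊆ spectrum ℂ T := by
  intro μ hμ hA
  obtain ⟨w, hw⟩ := Module.End.HasEigenvalue.exists_hasEigenvector hμ
  have hTw : dualOperator (dualOperator T) w = μ • w := hw.apply_eq_smul
  obtain ⟨B, -, hB⟩ := isUnit_iff_exists.1 hA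
  refine hw.2 (ContinuousLinearMap.ext fun f => ?_)
  -- A left inverse `B` of `μ - T` makes `μ - T'` surjective, and an eigenvector of `T''` for `μ`
  -- annihilates its range.
  have hf : f = μ • f.comp B - dualOperator T (f.comp B) := by
    ext x
    have h1 : B (μ • x - T x) = x := by
      have := congrArg (fun A : X →L[ℂ] X => A x) hB
      simpa [Algebra.algebraMap_eq_smul_one, mul_apply_eq_comp] using this
    rw [map_sub, map_smul] at h1
    conv_lhs => rw [← h1, map_sub, map_smul]
    rfl
  have h2 : w (dualOperator T (f.comp B)) = μ • w (f.comp B) :=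
    congrArg (fun v : StrongDual ℂ (StrongDual ℂ X) => v (f.comp B)) hTw
  rw [hf, map_sub, map_smul, h2, sub_self]
  rfl

theorem mainTheorem4 {F : Type*} [NormedAddCommGroup F] [Lattice F] [HasSolidNorm F]
    [IsOrderedAddMonoid F] [NormedSpace ℝ F] [IsOrderedModule ℝ F] [CompleteSpace F]
    (T : Complexification F →L[ℂ] Complexification F)
    (hT : Complexification.IsPositiveOperator T)
    (lam : ℂ) (hlam : ‖lam‖ = 1) (z : Complexification F)
    (hz : Module.End.HasEigenvector (T : Complexification F →ₗ[ℂ] Complexification F) lam z)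
    (h : BddAbove (Set.range fun n : ℕ => ‖(T ^ n) z.absval‖) ∨
      ∃ x : Complexification F,
        Module.End.HasEigenvector (T : Complexification F →ₗ[ℂ] Complexification F) 1 x ∧
          z.absval ≤ x) :
    (∀ k : ℤ, lam ^ k ∈ pointSpectrum (dualOperator (dualOperator T)) ∧ lam ^ k ∈ spectrum ℂ T) ∧
      pointSpectrum (dualOperator (dualOperator T)) ⊆ spectrum ℂ T := by
  have hsub : pointSpectrum (dualOperator (dualOperator T)) ⊆ spectrum ℂ T :=
    pointSpectrum_bidual_subset_spectrum T
  suffices hk : ∀ k : ℤ, lam ^ k ∈ pointSpectrum (dualOperator (dualOperator T)) from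
    ⟨fun k => ⟨hk k, hsub (hk k)⟩, hsub⟩
  obtain ⟨S, hTS⟩ := hT.exists_isEntrywise
  -- Both alternatives are used only through this bound; in case (b), `0 ≤ S ^ n |z| ≤ S ^ n x = x`.
  obtain ⟨C, hC⟩ : ∃ C, ∀ n : ℕ, ‖(S ^ n) z.modulus‖ ≤ C := by
    rcases h with ⟨C, hC⟩ | ⟨x, hx, -, -, hzx⟩
    · refine ⟨C, fun n => le_trans ?_ (hC ⟨n, rfl⟩)⟩
      have h1 := Complexification.norm_re_le ((T ^ n) z.absval)
      rwa [show ((T ^ n) z.absval).re = (S ^ n) z.modulus from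
        congrArg Complexification.re ((hTS.pow n).2 z.absval)] at h1
    · have hSx : S x.re = x.re := by
        have h1 : T x = (1 : ℂ) • x := hx.apply_eq_smul
        rw [one_smul, hTS.2] at h1
        exact congrArg Complexification.re h1
      refine ⟨‖x.re‖, fun n => Complexification.norm_le_norm_of_le ?_ ?_⟩
      · rw [← map_zero (S ^ n)]
        exact (hTS.pow n).1 z.modulus_nonneg
      · have h2 : (S ^ n) x.re = x.re := by
          rw [Module.End.pow_apply]
          exact Function.iterate_fixed hSx n
        rw [← h2]
        exact (hTS.pow n).1 hzx
  obtain ⟨l, rfl⟩ : ∃ l : Circle, (l : ℂ) = lam :=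
    ⟨⟨lam, mem_sphere_zero_iff_norm.2 hlam⟩, rfl⟩
  exact fun k => Complexification.zpow_mem_pointSpectrum_bidual hTS hz.2 hz.apply_eq_smul hC k
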